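/- \textbf{Theorem.} Parametric quotient types are not definable in second order dependent type theory $\lambda P2$. Here $\lambda P2$ is the pure type system with sorts $\star,\mathsf{Kind}$, axiom $\star:\mathsf{Kind}$, products $\Pi x{:}U.\,T$ formed for all pairs of sorts except $(\mathsf{Kind},\mathsf{Kind})$, and $\beta$-conversion; and $t=_\sigma q$ abbreviates Leibniz equality $\Pi P{:}\sigma\to\star.\ P\,t\to P\,q$. A \emph{parametric quotient type} consists of 1. a type $\alpha/R:\star$ in the context $\alpha:\star,\ R:\alpha\to\alpha\to\star$; for $\sigma:\star$ and $R:\sigma\to\sigma\to\star$ in any context, $\sigma/R$ denotes its instance; 2. a closed term $\mathsf{cls}:\Pi\alpha{:}\star.\ \Pi R{:}\alpha\to\alpha\to\star.\ \alpha\to\alpha/R$; 3. such that for all $\sigma:\star$ and $R:\sigma\to\sigma\to\star$ in a context $\Gamma$, the type $\Pi x,y{:}\sigma.\ R\,x\,y\to \mathsf{cls}\,\sigma\,R\,x=_{\sigma/R}\mathsf{cls}\,\sigma\,R\,y$ is inhabited in $\Gamma$; 4. an operation that assigns to all $\sigma:\star$, $R:\sigma\to\sigma\to\star$, $\tau:\star$,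 $f:\sigma\to\tau$ and $p:\Pi x,y{:}\sigma.\ R\,x\,y\to f\,x=_\tau f\,y$ in a context $\Gamma$ a term $\widehat f=\mathsf{rec}_{\mathsf q}\,p\,f:\sigma/R\to\tau$ in $\Gamma$; 5. such that $\widehat f\,(\mathsf{cls}\,\sigma\,R\,x)=_\beta f\,x$ for every term $x:\sigma$ in $\Gamma$. The theorem says that no such data exist. -/

import Mathlib

/-! Second order dependent type theory `λP2`, presented with de Bruijn indices, Leibniz equality,
and parametric quotient types. -/

namespace LambdaP2

/-- The two sorts `⋆` and `Kind`. -/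
inductive Srt : Type
  | star : Srt
  | kind : Srt

/-- Pseudo-terms. In `pi U T` and `lam U b` the second argument lives under one more binder. -/
inductive Tm : Type
  | sort : Srt → Tm
  | var : ℕ → Tm
  | pi : Tm → Tm → Tm
  | lam : Tm → Tm → Tm
  | app : Tm → Tm → Tm

/-- The universe `⋆` as a pseudo-term. -/
def Tm.star : Tm := Tm.sort Srt.star

/-- Lift a renaming under a binder. -/
def upRen (r : ℕ → ℕ) : ℕ → ℕ
  | 0 => 0
  | n + 1 => r n + 1

/-- Renaming of the free variables. -/
def Tm.rename : Tm → (ℕ → ℕ) → Tm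
  | .sort s, _ => .sort s
  | .var n, r => .var (r n)
  | .pi U T, r => .pi (U.rename r) (T.rename (upRen r))
  | .lam U b, r => .lam (U.rename r) (b.rename (upRen r))
  | .app f a, r => .app (f.rename r) (a.rename r)

/-- Weakening by one variable. -/
def Tm.shift (M : Tm) : Tm := M.rename Nat.succ

/-- Extend a substitution by the value `N` for variable `0`. -/
def scons (N : Tm) (θ : ℕ → Tm) : ℕ → Tm
  | 0 => N
  | n + 1 => θ n

/-- Lift a substitution under a binder. -/
def upSubst (θ : ℕ → Tm) : ℕ → Tm :=
  scons (.var 0) (fun n => (θ n).shift)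

/-- Parallel capture-avoiding substitution. -/
def Tm.subst : Tm → (ℕ → Tm) → Tm
  | .sort s, _ => .sort s
  | .var n, θ => θ n
  | .pi U T, θ => .pi (U.subst θ) (T.subst (upSubst θ))
  | .lam U b, θ => .lam (U.subst θ) (b.subst (upSubst θ))
  | .app f a, θ => .app (f.subst θ) (a.subst θ)

/-- `T[x := a]`, where `x` is the variable `0` of `T`. -/
def Tm.inst (T a : Tm) : Tm := T.subst (scons a Tm.var)

/-- One-step `β`-reduction: the compatible closure of `(λ x : U. b) a ⟶ b[x := a]`. -/
inductive Step : Tm → Tm → Prop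
  | beta (U b a : Tm) : Step (.app (.lam U b) a) (b.inst a)
  | piL {U U' : Tm} (T : Tm) : Step U U' → Step (.pi U T) (.pi U' T)
  | piR (U : Tm) {T T' : Tm} : Step T T' → Step (.pi U T) (.pi U T')
  | lamL {U U' : Tm} (b : Tm) : Step U U' → Step (.lam U b) (.lam U' b)
  | lamR (U : Tm) {b b' : Tm} : Step b b' → Step (.lam U b) (.lam U b')
  | appL {f f' : Tm} (a : Tm) : Step f f' → Step (.app f a) (.app f' a)
  | appR (f : Tm) {a a' : Tm} : Step a a' → Step (.app f a) (.app f a')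

/-- `β`-equality: the reflexive, symmetric, transitive closure of `Step`. -/
def BetaEq : Tm → Tm → Prop := Relation.EqvGen Step

/-- Contexts; the head of the list is the declaration of variable `0` (the last one declared),
and each type lives in the context formed by the rest of the list. -/
abbrev Ctx : Type := List Tm

/-- Derivable judgments `Γ ⊢ M : T` of `λP2`. -/
inductive Typing : Ctx → Tm → Tm → Prop
  | ax : Typing [] (.sort .star) (.sort .kind)
  | var {Γ : Ctx} {T : Tm} {s : Srt} :
      Typing Γ T (.sort s) → Typing (T :: Γ) (.var 0) T.shift
  | weak {Γ : Ctx} {T M U : Tm} {s : Srt} :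
      Typing Γ M U → Typing Γ T (.sort s) → Typing (T :: Γ) M.shift U.shift
  | conv {Γ : Ctx} {M T U : Tm} {s : Srt} :
      Typing Γ M T → Typing Γ U (.sort s) → BetaEq T U → Typing Γ M U
  | pi {Γ : Ctx} {U T : Tm} {s₁ s₂ : Srt} :
      ¬ (s₁ = .kind ∧ s₂ = .kind) →
      Typing Γ U (.sort s₁) → Typing (U :: Γ) T (.sort s₂) →
      Typing Γ (.pi U T) (.sort s₂)
  | lam {Γ : Ctx} {U T b : Tm} {s : Srt} :
      Typing Γ (.pi U T) (.sort s) → Typing (U :: Γ) b T →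
      Typing Γ (.lam U b) (.pi U T)
  | app {Γ : Ctx} {U T f a : Tm} :
      Typing Γ f (.pi U T) → Typing Γ a U → Typing Γ (.app f a) (T.inst a)

/-- The non-dependent function type `A → B`. -/
def arrow (A B : Tm) : Tm := .pi A B.shift

/-- The kind `A → A → ⋆` of binary relations on `A`. -/
def relOn (A : Tm) : Tm := arrow A (arrow A .star)

/-- Leibniz equality `t =_σ q`, that is `Π P : σ → ⋆. P t → P q`. -/
def leibnizEq (σ t q : Tm) : Tm :=
  .pi (arrow σ .star) (arrow (.app (.var 0) t.shift) (.app (.var 0) q.shift))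

/-- The type `Π x y : σ. R x y → f x =_τ f y`: the function `f : σ → τ` respects `R`. -/
def resp (σ τ R f : Tm) : Tm :=
  .pi σ (.pi σ.shift
    (arrow (.app (.app R.shift.shift (.var 1)) (.var 0))
      (leibnizEq τ.shift.shift
        (.app f.shift.shift (.var 1)) (.app f.shift.shift (.var 0)))))

/-- The instance `σ/R` of a type `Q` that lives in the context `α : ⋆, R : α → α → ⋆`
(there `R` is variable `0` and `α` is variable `1`). -/
def quotAt (Q σ R : Tm) : Tm := Q.subst (scons R (scons σ Tm.var))

/-- The class map `cls σ R` at `σ` and `R`; `cls` is a closed term, so it needs no weakening. -/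
def clsAt (cls σ R : Tm) : Tm := .app (.app cls σ) R

/-- A parametric quotient type in `λP2`. The recursor `recq` is an arbitrary operation on (pseudo-)
terms in context, subject only to the typing and computation rules. -/
structure ParametricQuotient where
  /-- The type `α/R`, in the context `α : ⋆, R : α → α → ⋆`. -/
  Q : Tm
  Q_typed : Typing [relOn (.var 0), .star] Q .star
  /-- The polymorphic class map `cls : Π α : ⋆. Π R : α → α → ⋆. α → α/R`. -/
  cls : Tm
  cls_typed : Typing [] cls (.pi .star (.pi (relOn (.var 0)) (arrow (.var 1) Q)))
  /-- `Π x y : σ. R x y → cls σ R x =_{σ/R} cls σ R y` is inhabited. -/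
  cls_resp : ∀ (Γ : Ctx) (σ R : Tm), Typing Γ σ .star → Typing Γ R (relOn σ) →
    ∃ M : Tm, Typing Γ M (resp σ (quotAt Q σ R) R (clsAt cls σ R))
  /-- The recursor; `recq Γ σ R τ p f` is the lifting of `f` along `cls σ R`. -/
  recq : Ctx → Tm → Tm → Tm → Tm → Tm → Tm
  recq_typed : ∀ (Γ : Ctx) (σ R τ p f : Tm), Typing Γ σ .star → Typing Γ R (relOn σ) →
    Typing Γ τ .star → Typing Γ f (arrow σ τ) → Typing Γ p (resp σ τ R f) →
    Typing Γ (recq Γ σ R τ p f) (arrow (quotAt Q σ R) τ)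
  recq_cls : ∀ (Γ : Ctx) (σ R τ p f : Tm), Typing Γ σ .star → Typing Γ R (relOn σ) →
    Typing Γ τ .star → Typing Γ f (arrow σ τ) → Typing Γ p (resp σ τ R f) →
    ∀ x : Tm, Typing Γ x σ →
      BetaEq (.app (recq Γ σ R τ p f) (.app (clsAt cls σ R) x)) (.app f x)

end LambdaP2

namespace LambdaP2

/-! ### Substitution calculus -/

/-! Terms are interpreted in the graph model `𝒫(ℕ)` with annotations erased (`obj`), types as
arbitrary sets of elements (`den`). Types and constant relations leave no trace in object values, so
`cls σ R` has the same value for the two relations used below (`obj_clsAt_constRel`). Products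
quantify over all families of sets, so an inhabited Leibniz equality forces equal values
(`obj_eq_of_mem_den_leibnizEq`). Let `α` denote all of `𝒫(ℕ)`. For the relation with constant value
`α`, which is inhabited, the class map identifies any two points. For the constantly absurd relation
every map lifts (`exists_resp_absurdTy`), and the lift of the identity is a left inverse of the
class map. As both class maps have one value, `∅ = Set.univ`.

The work is in soundness (`Typing.sound`), where conversion is the obstacle: `den` respects β only
on terms with a level (`Lev`). Typable types and kinds have one because (Kind, Kind) products are
absent, and Church–Rosser bypasses the untyped terms that a conversion may visit. -/

theorem upRen_comp (r r' : ℕ → ℕ) : upRen r' ∘ upRen r = upRen (r' ∘ r) := by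
  funext n; cases n <;> rfl

theorem Tm.rename_rename (M : Tm) (r r' : ℕ → ℕ) :
    (M.rename r).rename r' = M.rename (r' ∘ r) := by
  induction M generalizing r r' <;> simp_all [Tm.rename, upRen_comp]

theorem upSubst_comp_upRen (r : ℕ → ℕ) (θ : ℕ → Tm) :
    upSubst θ ∘ upRen r = upSubst (θ ∘ r) := by
  funext n; cases n <;> rfl

theorem Tm.subst_rename (M : Tm) (r : ℕ → ℕ) (θ : ℕ → Tm) :
    (M.rename r).subst θ = M.subst (θ ∘ r) := by
  induction M generalizing r θ <;> simp_all [Tm.rename, Tm.subst, upSubst_comp_upRen]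

theorem rename_upSubst (r : ℕ → ℕ) (θ : ℕ → Tm) :
    (fun n => (upSubst θ n).rename (upRen r)) = upSubst (fun n => (θ n).rename r) := by
  funext n
  cases n with
  | zero => rfl
  | succ n => simp only [upSubst, scons, Tm.shift, Tm.rename_rename]; rfl

theorem Tm.rename_subst (M : Tm) (θ : ℕ → Tm) (r : ℕ → ℕ) :
    (M.subst θ).rename r = M.subst (fun n => (θ n).rename r) := by
  induction M generalizing r θ <;> simp_all [Tm.rename, Tm.subst, rename_upSubst]

theorem subst_upSubst (θ η : ℕ → Tm) :
    (fun n => (upSubst θ n).subst (upSubst η)) = upSubst (fun n => (θ n).subst η) := by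
  funext n
  cases n with
  | zero => rfl
  | succ n => simp only [upSubst, scons, Tm.shift, Tm.subst_rename, Tm.rename_subst]; rfl

theorem Tm.subst_subst (M : Tm) (θ η : ℕ → Tm) :
    (M.subst θ).subst η = M.subst (fun n => (θ n).subst η) := by
  induction M generalizing θ η <;> simp_all [Tm.subst, subst_upSubst]

theorem upSubst_var : upSubst Tm.var = Tm.var := by
  funext n; cases n <;> rfl

theorem Tm.subst_var (M : Tm) : M.subst Tm.var = M := by
  induction M <;> simp_all [Tm.subst, upSubst_var]

theorem Tm.inst_shift (M N : Tm) : M.shift.inst N = M := by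
  rw [Tm.inst, Tm.shift, Tm.subst_rename]
  exact M.subst_var

theorem Tm.inst_rename (b a : Tm) (r : ℕ → ℕ) :
    (b.inst a).rename r = (b.rename (upRen r)).inst (a.rename r) := by
  rw [Tm.inst, Tm.inst, Tm.rename_subst, Tm.subst_rename]
  congr 1; funext n; cases n <;> rfl

theorem Tm.inst_subst (b a : Tm) (θ : ℕ → Tm) :
    (b.inst a).subst θ = (b.subst (upSubst θ)).inst (a.subst θ) := by
  rw [Tm.inst, Tm.inst, Tm.subst_subst, Tm.subst_subst]
  congr 1; funext n
  cases n with
  | zero => rfl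
  | succ n => exact ((θ n).inst_shift _).symm

/-! ### The Church–Rosser property -/

/-- Parallel `β`-reduction. -/
inductive Par : Tm → Tm → Prop
  | sort (s : Srt) : Par (.sort s) (.sort s)
  | var (n : ℕ) : Par (.var n) (.var n)
  | pi {U U' T T' : Tm} : Par U U' → Par T T' → Par (.pi U T) (.pi U' T')
  | lam {U U' b b' : Tm} : Par U U' → Par b b' → Par (.lam U b) (.lam U' b')
  | app {f f' a a' : Tm} : Par f f' → Par a a' → Par (.app f a) (.app f' a')
  | beta (U : Tm) {b b' a a' : Tm} : Par b b' → Par a a' → Par (.app (.lam U b) a) (b'.inst a')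

theorem Par.refl (M : Tm) : Par M M := by
  induction M <;> constructor <;> assumption

theorem Par.rename {M N : Tm} (h : Par M N) (r : ℕ → ℕ) : Par (M.rename r) (N.rename r) := by
  induction h generalizing r with
  | sort s => exact .sort s
  | var n => exact .var _
  | pi _ _ h₁ h₂ => exact .pi (h₁ r) (h₂ _)
  | lam _ _ h₁ h₂ => exact .lam (h₁ r) (h₂ _)
  | app _ _ h₁ h₂ => exact .app (h₁ r) (h₂ r)
  | beta U _ _ h₁ h₂ => rw [Tm.inst_rename]; exact .beta _ (h₁ _) (h₂ r)

theorem Par.upSubst {θ η : ℕ → Tm} (h : ∀ n, Par (θ n) (η n)) (n : ℕ) :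
    Par (upSubst θ n) (upSubst η n) := by
  cases n with
  | zero => exact .var 0
  | succ n => exact (h n).rename _

theorem Par.subst {M N : Tm} (h : Par M N) {θ η : ℕ → Tm} (hθ : ∀ n, Par (θ n) (η n)) :
    Par (M.subst θ) (N.subst η) := by
  induction h generalizing θ η with
  | sort s => exact .sort s
  | var n => exact hθ n
  | pi _ _ h₁ h₂ => exact .pi (h₁ hθ) (h₂ (Par.upSubst hθ))
  | lam _ _ h₁ h₂ => exact .lam (h₁ hθ) (h₂ (Par.upSubst hθ))
  | app _ _ h₁ h₂ => exact .app (h₁ hθ) (h₂ hθ)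
  | beta U _ _ h₁ h₂ => rw [Tm.inst_subst]; exact .beta _ (h₁ (Par.upSubst hθ)) (h₂ hθ)

theorem Par.inst {b b' a a' : Tm} (hb : Par b b') (ha : Par a a') :
    Par (b.inst a) (b'.inst a') :=
  hb.subst fun n => by
    cases n with
    | zero => exact ha
    | succ n => exact .var n

/-- Complete development: contract all redexes of a term simultaneously. -/
def Tm.dev : Tm → Tm
  | .sort s => .sort s
  | .var n => .var n
  | .pi U T => .pi U.dev T.dev
  | .lam U b => .lam U.dev b.dev
  | .app (.lam _ b) a => b.dev.inst a.dev
  | .app f a => .app f.dev a.dev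

/-- Takahashi's triangle property: the complete development depends on `M` alone, so it closes every
parallel peak at once. -/
theorem Par.dev {M N : Tm} (h : Par M N) : Par N M.dev := by
  induction h with
  | sort s => exact .sort s
  | var n => exact .var n
  | pi _ _ h₁ h₂ => exact .pi h₁ h₂
  | lam _ _ h₁ h₂ => exact .lam h₁ h₂
  | beta U _ _ h₁ h₂ => simpa only [Tm.dev] using h₁.inst h₂
  | @app f f' a a' hf ha h₁ h₂ =>
    -- Only when the head is an abstraction does the development contract this application.
    cases hf with
    | lam hU hb =>
      simp only [Tm.dev] at h₁ ⊢
      cases h₁ with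
      | lam _ hb' => exact .beta _ hb' h₂
    | _ => exact .app h₁ h₂

theorem Step.par {M N : Tm} (h : Step M N) : Par M N := by
  induction h with
  | beta U b a => exact .beta U (.refl b) (.refl a)
  | piL T _ ih => exact .pi ih (.refl T)
  | piR U _ ih => exact .pi (.refl U) ih
  | lamL b _ ih => exact .lam ih (.refl b)
  | lamR U _ ih => exact .lam (.refl U) ih
  | appL a _ ih => exact .app ih (.refl a)
  | appR f _ ih => exact .app (.refl f) ih

/-- Many-step `β`-reduction. -/
abbrev Steps : Tm → Tm → Prop := Relation.ReflTransGen Step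

theorem Par.steps {M N : Tm} (h : Par M N) : Steps M N := by
  induction h with
  | sort s => exact .refl
  | var n => exact .refl
  | @pi U U' T T' _ _ h₁ h₂ =>
    exact (h₁.lift (Tm.pi · T) fun _ _ => Step.piL T).trans
      (h₂.lift (Tm.pi U') fun _ _ => Step.piR U')
  | @lam U U' T T' _ _ h₁ h₂ =>
    exact (h₁.lift (Tm.lam · T) fun _ _ => Step.lamL T).trans
      (h₂.lift (Tm.lam U') fun _ _ => Step.lamR U')
  | @app U U' T T' _ _ h₁ h₂ =>
    exact (h₁.lift (Tm.app · T) fun _ _ => Step.appL T).trans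
      (h₂.lift (Tm.app U') fun _ _ => Step.appR U')
  | @beta U b b' a a' _ _ h₁ h₂ =>
    have h₃ : Steps (.lam U b) (.lam U b') := h₁.lift (Tm.lam U) fun _ _ => Step.lamR U
    exact ((h₃.lift (Tm.app · a) fun _ _ => Step.appL a).trans
      (h₂.lift (Tm.app (.lam U b')) fun _ _ => Step.appR _)).tail (.beta U b' a')

theorem Steps.par {M N : Tm} (h : Steps M N) : Relation.ReflTransGen Par M N :=
  h.lift id fun _ _ => Step.par

theorem BetaEq.common_reduct {M N : Tm} (h : BetaEq M N) : ∃ V, Steps M V ∧ Steps N V := by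
  have diamond : ∀ a b c : Tm, Par a b → Par a c →
      ∃ d, Relation.ReflGen Par b d ∧ Relation.ReflTransGen Par c d :=
    fun a b c hb hc => ⟨a.dev, .single hb.dev, .single hc.dev⟩
  have toSteps : ∀ a b : Tm, Relation.ReflTransGen Par a b → Steps a b := fun a b hab => by
    induction hab with
    | refl => exact .refl
    | tail _ h ih => exact ih.trans h.steps
  induction h with
  | rel _ y h => exact ⟨y, .single h, .refl⟩
  | refl x => exact ⟨x, .refl, .refl⟩
  | symm _ _ _ ih => obtain ⟨V, h₁, h₂⟩ := ih; exact ⟨V, h₂, h₁⟩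
  | trans _ _ _ _ _ ih₁ ih₂ =>
    obtain ⟨V, h₁, h₂⟩ := ih₁
    obtain ⟨W, h₃, h₄⟩ := ih₂
    obtain ⟨Z, h₅, h₆⟩ := Relation.church_rosser diamond h₂.par h₃.par
    exact ⟨Z, h₁.trans (toSteps _ _ h₅), h₄.trans (toSteps _ _ h₆)⟩

/-! ### The graph model -/

/-- Extend a sequence by a new value at `0`. -/
def push {X : Type*} (a : X) (e : ℕ → X) : ℕ → X
  | 0 => a
  | n + 1 => e n

theorem push_comp_upRen {X : Type*} (a : X) (e : ℕ → X) (r : ℕ → ℕ) :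
    push a e ∘ upRen r = push a (e ∘ r) := by
  funext n; cases n <;> rfl

/-- Application in the graph model `𝒫(ℕ)`. -/
def ap (F X : Set ℕ) : Set ℕ :=
  {b | ∃ s : Finset ℕ, (s : Set ℕ) ⊆ X ∧ Encodable.encode (s, b) ∈ F}

/-- The graph of a function on the graph model. -/
def graph (f : Set ℕ → Set ℕ) : Set ℕ :=
  {n | ∃ (s : Finset ℕ) (b : ℕ), n = Encodable.encode (s, b) ∧ b ∈ f s}

theorem ap_empty (X : Set ℕ) : ap ∅ X = ∅ := by
  ext; simp [ap]

/-- This is why an abstraction whose body is a type is as invisible to `obj` as the type itself. -/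
theorem graph_empty : graph (fun _ => ∅) = ∅ := by
  ext; simp [graph]

theorem mem_ap_graph {f : Set ℕ → Set ℕ} {X : Set ℕ} {b : ℕ} :
    b ∈ ap (graph f) X ↔ ∃ s : Finset ℕ, (s : Set ℕ) ⊆ X ∧ b ∈ f s := by
  constructor
  · rintro ⟨s, hs, s', b', h, hb⟩
    obtain ⟨rfl, rfl⟩ := Prod.mk.inj (Encodable.encode_injective h)
    exact ⟨s, hs, hb⟩
  · rintro ⟨s, hs, hb⟩
    exact ⟨s, hs, s, b, rfl, hb⟩

/-- The value of a pseudo-term as an element of the graph model. Type annotations are erased, and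
sorts and products have the value `∅`. -/
def obj : Tm → (ℕ → Set ℕ) → Set ℕ
  | .sort _, _ => ∅
  | .var n, e => e n
  | .pi _ _, _ => ∅
  | .lam _ b, e => graph fun a => obj b (push a e)
  | .app f a, e => ap (obj f e) (obj a e)

theorem push_mono {a a' : Set ℕ} {e e' : ℕ → Set ℕ} (ha : a ⊆ a') (he : ∀ n, e n ⊆ e' n) (n : ℕ) :
    push a e n ⊆ push a' e' n := by
  cases n with
  | zero => exact ha
  | succ n => exact he n

theorem obj_mono (M : Tm) {e e' : ℕ → Set ℕ} (h : ∀ n, e n ⊆ e' n) : obj M e ⊆ obj M e' := by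
  induction M generalizing e e' with
  | sort s => exact subset_rfl
  | var n => exact h n
  | pi U T _ _ => exact subset_rfl
  | lam U b _ ih =>
    rintro _ ⟨s, b, rfl, hb⟩
    exact ⟨s, b, rfl, ih (push_mono subset_rfl h) hb⟩
  | app f a hf ha =>
    rintro b ⟨s, hs, hb⟩
    exact ⟨s, hs.trans (ha h), hf h hb⟩

/-- Membership uses only finite information about each variable; this is what makes abstraction
followed by application exact in `ap_obj_lam`. -/
theorem obj_continuous (M : Tm) {e : ℕ → Set ℕ} {b : ℕ} (h : b ∈ obj M e) :
    ∃ φ : ℕ → Finset ℕ, (∀ n, (φ n : Set ℕ) ⊆ e n) ∧ b ∈ obj M fun n => φ n := by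
  classical
  induction M generalizing e b with
  | sort s => exact h.elim
  | var n =>
    refine ⟨fun m => if m = n then {b} else ∅, fun m => ?_, by simp [obj]⟩
    by_cases hm : m = n
    · subst hm; simpa [obj] using h
    · simp [hm]
  | pi U T _ _ => exact h.elim
  | lam U M _ ih =>
    obtain ⟨s, b, rfl, hb⟩ := h
    obtain ⟨φ, hφ, hb⟩ := ih hb
    refine ⟨fun n => φ (n + 1), fun n => hφ (n + 1), s, b, rfl, obj_mono M (fun n => ?_) hb⟩
    cases n with
    | zero => exact hφ 0
    | succ n => exact subset_rfl
  | app f a hf ha =>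
    obtain ⟨s, hs, hb⟩ := h
    obtain ⟨φ, hφ, hb⟩ := hf hb
    choose! ψ hψ hψs using fun c (hc : c ∈ s) => ha (hs hc)
    -- Join the approximation needed by `f` with those needed for the finitely many elements of `s`;
    -- monotonicity does the rest.
    refine ⟨fun n => φ n ∪ s.biUnion fun c => ψ c n, fun n => ?_, s, fun c hc => ?_, ?_⟩
    · intro m hm
      simp only [Finset.coe_union, Finset.coe_biUnion, Set.mem_union, Set.mem_iUnion] at hm
      obtain hm | ⟨c, hc, hm⟩ := hm
      · exact hφ n hm
      · exact hψ c hc n hm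
    · refine obj_mono a (fun n m hm => ?_) (hψs c hc)
      simp only [Finset.coe_union, Finset.coe_biUnion, Set.mem_union, Set.mem_iUnion]
      exact .inr ⟨c, hc, hm⟩
    · refine obj_mono f (fun n m hm => ?_) hb
      simp only [Finset.coe_union, Set.mem_union]
      exact .inl hm

theorem ap_obj_lam (U b : Tm) (e : ℕ → Set ℕ) (a : Set ℕ) :
    ap (obj (.lam U b) e) a = obj b (push a e) := by
  ext m
  refine mem_ap_graph.trans ⟨?_, fun h => ?_⟩
  · rintro ⟨s, hs, hm⟩
    exact obj_mono b (push_mono hs fun _ => subset_rfl) hm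
  · obtain ⟨φ, hφ, hm⟩ := obj_continuous b h
    refine ⟨φ 0, hφ 0, obj_mono b (fun n => ?_) hm⟩
    cases n with
    | zero => exact subset_rfl
    | succ n => exact hφ (n + 1)

theorem obj_rename (M : Tm) (r : ℕ → ℕ) (e : ℕ → Set ℕ) : obj (M.rename r) e = obj M (e ∘ r) := by
  induction M generalizing r e <;> simp_all [Tm.rename, obj, push_comp_upRen]

theorem obj_shift (M : Tm) (a : Set ℕ) (e : ℕ → Set ℕ) : obj M.shift (push a e) = obj M e :=
  obj_rename M _ _

theorem obj_upSubst (θ : ℕ → Tm) (a : Set ℕ) (e : ℕ → Set ℕ) :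
    (fun n => obj (upSubst θ n) (push a e)) = push a fun n => obj (θ n) e := by
  funext n
  cases n with
  | zero => rfl
  | succ n => exact obj_shift _ _ _

theorem obj_subst (M : Tm) (θ : ℕ → Tm) (e : ℕ → Set ℕ) :
    obj (M.subst θ) e = obj M fun n => obj (θ n) e := by
  induction M generalizing θ e <;> simp_all [Tm.subst, obj, obj_upSubst]

theorem obj_inst (b a : Tm) (e : ℕ → Set ℕ) : obj (b.inst a) e = obj b (push (obj a e) e) := by
  rw [Tm.inst, obj_subst]
  congr 1; funext n; cases n <;> rfl

theorem Step.obj_eq {M N : Tm} (h : Step M N) (e : ℕ → Set ℕ) : obj M e = obj N e := by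
  induction h generalizing e with
  | beta U b a => rw [obj, ap_obj_lam, obj_inst]
  | _ => simp_all [obj]

theorem BetaEq.obj_eq {M N : Tm} (h : BetaEq M N) (e : ℕ → Set ℕ) : obj M e = obj N e := by
  induction h with
  | rel _ _ h => exact h.obj_eq e
  | refl _ => rfl
  | symm _ _ _ ih => exact ih.symm
  | trans _ _ _ _ _ ih₁ ih₂ => exact ih₁.trans ih₂

/-- Values of type constructors: sets depending on a list of arguments. -/
abbrev Fam : Type := List (Set ℕ) → Set (Set ℕ)

/-- The value of a pseudo-term as a type constructor; `e` and `d` give the values of the variables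
as elements of the graph model and as type constructors. -/
def den : Tm → (ℕ → Set ℕ) → (ℕ → Fam) → Fam
  | .sort _, _, _ => fun _ => {∅}
  | .var n, _, d => d n
  | .pi U T, e, d => fun _ =>
      {f | ∀ a ∈ den U e d [], ∀ P : Fam, ap f a ∈ den T (push a e) (push P d) []}
  | .lam _ b, e, d => fun l =>
      match l with
      | [] => ∅
      -- The bound variable gets a dummy family: arguments are recorded only as objects, so a λ over
      -- a kind is not modelled faithfully. Levels exclude it at constructor level.
      | a :: l => den b (push a e) (push (fun _ => ∅) d) l
  | .app f a, e, d => fun l => den f e d (obj a e :: l)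

theorem den_rename (M : Tm) (r : ℕ → ℕ) (e : ℕ → Set ℕ) (d : ℕ → Fam) :
    den (M.rename r) e d = den M (e ∘ r) (d ∘ r) := by
  induction M generalizing r e d <;> simp_all [Tm.rename, den, obj_rename, push_comp_upRen]

theorem den_shift (M : Tm) (a : Set ℕ) (P : Fam) (e : ℕ → Set ℕ) (d : ℕ → Fam) :
    den M.shift (push a e) (push P d) = den M e d :=
  den_rename M _ _ _

theorem den_upSubst (θ : ℕ → Tm) (a : Set ℕ) (P : Fam) (e : ℕ → Set ℕ) (d : ℕ → Fam) :
    (fun n => den (upSubst θ n) (push a e) (push P d)) = push P fun n => den (θ n) e d := by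
  funext n
  cases n with
  | zero => rfl
  | succ n => exact den_shift _ _ _ _ _

theorem den_subst (M : Tm) (θ : ℕ → Tm) (e : ℕ → Set ℕ) (d : ℕ → Fam) :
    den (M.subst θ) e d = den M (fun n => obj (θ n) e) fun n => den (θ n) e d := by
  induction M generalizing θ e d <;> simp_all [Tm.subst, den, obj_subst, obj_upSubst, den_upSubst]

theorem den_inst (b a : Tm) (e : ℕ → Set ℕ) (d : ℕ → Fam) :
    den (b.inst a) e d = den b (push (obj a e) e) (push (den a e d) d) := by
  rw [Tm.inst, den_subst]
  congr 1 <;> funext n <;> cases n <;> rfl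

/-! ### Levels -/

/-- `Lev ℓ true M` says that `M` has the shape of a type constructor, and `Lev ℓ false M` that `M`
has the shape of a kind, where `ℓ n` says that the variable `n` stands for a type constructor.
Nothing is required of terms in argument position. -/
inductive Lev : (ℕ → Prop) → Bool → Tm → Prop
  | var {ℓ : ℕ → Prop} {n : ℕ} : ℓ n → Lev ℓ true (.var n)
  | star {ℓ : ℕ → Prop} : Lev ℓ false (.sort .star)
  | piType {ℓ : ℕ → Prop} {k : Bool} {U T : Tm} :
      Lev ℓ true U → Lev (push False ℓ) k T → Lev ℓ k (.pi U T)
  | piKind {ℓ : ℕ → Prop} {U T : Tm} :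
      Lev ℓ false U → Lev (push True ℓ) true T → Lev ℓ true (.pi U T)
  | lam {ℓ : ℕ → Prop} {U b : Tm} : Lev (push False ℓ) true b → Lev ℓ true (.lam U b)
  | app {ℓ : ℕ → Prop} {f a : Tm} : Lev ℓ true f → Lev ℓ true (.app f a)

theorem Lev.not_kind {ℓ : ℕ → Prop} {M : Tm} (h : Lev ℓ true M) : ¬ Lev ℓ false M := by
  induction M generalizing ℓ with
  | pi U T hU hT =>
    intro h'
    cases h' with
    | piType h₁ h₂ =>
      cases h with
      | piType _ h₃ => exact hT h₃ h₂
      | piKind h₃ _ => exact hU h₁ h₃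
  | sort s => cases h
  | _ => intro h'; cases h'

theorem push_imp {p q : Prop} {ℓ ℓ' : ℕ → Prop} {r : ℕ → ℕ} (hp : p → q)
    (h : ∀ n, ℓ n → ℓ' (r n)) (n : ℕ) : push p ℓ n → push q ℓ' (upRen r n) := by
  cases n with
  | zero => exact hp
  | succ n => exact h n

theorem Lev.rename {ℓ ℓ' : ℕ → Prop} {k : Bool} {M : Tm} (h : Lev ℓ k M) {r : ℕ → ℕ}
    (hr : ∀ n, ℓ n → ℓ' (r n)) : Lev ℓ' k (M.rename r) := by
  induction h generalizing ℓ' r with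
  | var h => exact .var (hr _ h)
  | star => exact .star
  | piType _ _ h₁ h₂ => exact .piType (h₁ hr) (h₂ (push_imp id hr))
  | piKind _ _ h₁ h₂ => exact .piKind (h₁ hr) (h₂ (push_imp id hr))
  | lam _ h => exact .lam (h (push_imp id hr))
  | app _ h => exact .app (h hr)

theorem Lev.subst {ℓ ℓ' : ℕ → Prop} {k : Bool} {M : Tm} (h : Lev ℓ k M) {θ : ℕ → Tm}
    (hθ : ∀ n, ℓ n → Lev ℓ' true (θ n)) : Lev ℓ' k (M.subst θ) := by
  have up : ∀ (p : Prop) {ℓ ℓ' : ℕ → Prop} {θ : ℕ → Tm}, (∀ n, ℓ n → Lev ℓ' true (θ n)) →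
      ∀ n, push p ℓ n → Lev (push p ℓ') true (upSubst θ n) := by
    intro p ℓ ℓ' θ h n hn
    cases n with
    | zero => exact .var hn
    | succ n => exact (h n hn).rename fun _ => id
  induction h generalizing ℓ' θ with
  | var h => exact hθ _ h
  | star => exact .star
  | piType _ _ h₁ h₂ => exact .piType (h₁ hθ) (h₂ (up _ hθ))
  | piKind _ _ h₁ h₂ => exact .piKind (h₁ hθ) (h₂ (up _ hθ))
  | lam _ h => exact .lam (h (up _ hθ))
  | app _ h => exact .app (h hθ)

theorem Lev.mono {ℓ ℓ' : ℕ → Prop} {k : Bool} {M : Tm} (h : Lev ℓ k M)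
    (hℓ : ∀ n, ℓ n → ℓ' n) : Lev ℓ' k M := by
  have := h.subst (θ := Tm.var) fun n hn => .var (hℓ n hn)
  rwa [Tm.subst_var] at this

theorem Lev.inst {ℓ : ℕ → Prop} {p : Prop} {k : Bool} {b a : Tm} (h : Lev (push p ℓ) k b)
    (ha : p → Lev ℓ true a) : Lev ℓ k (b.inst a) :=
  h.subst fun n hn => by
    cases n with
    | zero => exact ha hn
    | succ n => exact .var hn

/-- In a β-redex with a level, the bound variable is not a constructor variable, so the argument
needs no level of its own. -/
theorem Lev.step {ℓ : ℕ → Prop} {k : Bool} {M N : Tm} (h : Lev ℓ k M) (hs : Step M N) :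
    Lev ℓ k N := by
  induction hs generalizing ℓ k with
  | beta U b a =>
    cases h with
    | app h => cases h with
      | lam h => exact h.inst False.elim
  | piL T _ ih =>
    cases h with
    | piType h₁ h₂ => exact .piType (ih h₁) h₂
    | piKind h₁ h₂ => exact .piKind (ih h₁) h₂
  | piR U _ ih =>
    cases h with
    | piType h₁ h₂ => exact .piType h₁ (ih h₂)
    | piKind h₁ h₂ => exact .piKind h₁ (ih h₂)
  | lamL b _ ih => cases h with | lam h => exact .lam h
  | lamR U _ ih => cases h with | lam h => exact .lam (ih h)
  | appL a _ ih => cases h with | app h => exact .app (ih h)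
  | appR f _ ih => cases h with | app h => exact .app h

theorem Lev.steps {ℓ : ℕ → Prop} {k : Bool} {M N : Tm} (h : Lev ℓ k M) (hs : Steps M N) :
    Lev ℓ k N := by
  induction hs with
  | refl => exact h
  | tail _ hs ih => exact ih.step hs

theorem Lev.den_congr {ℓ : ℕ → Prop} {k : Bool} {M : Tm} (h : Lev ℓ k M) (e : ℕ → Set ℕ)
    {d d' : ℕ → Fam} (hd : ∀ n, ℓ n → d n = d' n) : den M e d = den M e d' := by
  have up : ∀ (p : Prop) {ℓ : ℕ → Prop} {d d' : ℕ → Fam} {P P' : Fam}, (p → P = P') →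
      (∀ n, ℓ n → d n = d' n) → ∀ n, push p ℓ n → push P d n = push P' d' n := by
    intro p ℓ d d' P P' hP h n
    cases n with
    | zero => exact hP
    | succ n => exact h n
  induction h generalizing e d d' with
  | var h => exact hd _ h
  | star => rfl
  | piType _ _ h₁ h₂ =>
    have h₃ := fun a P => h₂ (push a e) (up False (P := P) (P' := P) False.elim hd)
    simp only [den, h₁ e hd, h₃]
  | piKind _ _ h₁ h₂ =>
    have h₃ := fun a P => h₂ (push a e) (up True (P := P) (P' := P) (fun _ => rfl) hd)
    simp only [den, h₁ e hd, h₃]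
  | lam _ h =>
    have h₃ := fun a P => h (push a e) (up False (P := P) (P' := P) False.elim hd)
    simp only [den, h₃]
  | app _ h => simp only [den, h e hd]

/-- At a β-redex the two sides differ only in the family given to the bound variable: a dummy or the
value of the argument. By the level condition and `Lev.den_congr` that family is never consulted. -/
theorem Lev.den_step {ℓ : ℕ → Prop} {k : Bool} {M N : Tm} (h : Lev ℓ k M) (hs : Step M N)
    (e : ℕ → Set ℕ) (d : ℕ → Fam) : den M e d = den N e d := by
  induction hs generalizing ℓ k e d with
  | beta U b a =>
    cases h with
    | app h => cases h with
      | lam h =>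
        rw [den_inst]
        refine h.den_congr _ fun n hn => ?_
        cases n with
        | zero => exact hn.elim
        | succ n => rfl
  | piL T _ ih =>
    cases h with
    | piType h₁ h₂ => simp only [den, ih h₁]
    | piKind h₁ h₂ => simp only [den, ih h₁]
  | piR U _ ih =>
    cases h with
    | piType h₁ h₂ => simp only [den, ih h₂]
    | piKind h₁ h₂ => simp only [den, ih h₂]
  | lamL b _ ih => rfl
  | lamR U _ ih => cases h with | lam h => simp only [den, ih h]
  | appL a _ ih => cases h with | app h => simp only [den, ih h]
  | appR f hs ih => simp only [den, hs.obj_eq]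

theorem Lev.den_steps {ℓ : ℕ → Prop} {k : Bool} {M N : Tm} (h : Lev ℓ k M) (hs : Steps M N)
    (e : ℕ → Set ℕ) (d : ℕ → Fam) : den M e d = den N e d := by
  induction hs with
  | refl => rfl
  | tail hs₁ hs₂ ih => exact ih.trans ((h.steps hs₁).den_step hs₂ e d)

/-- Only the endpoints need levels: going down to a common reduct avoids intermediate terms that
have none. -/
theorem BetaEq.den_eq {ℓ : ℕ → Prop} {k k' : Bool} {M N : Tm} (h : BetaEq M N) (hM : Lev ℓ k M)
    (hN : Lev ℓ k' N) (e : ℕ → Set ℕ) (d : ℕ → Fam) : den M e d = den N e d := by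
  obtain ⟨V, h₁, h₂⟩ := h.common_reduct
  exact (hM.den_steps h₁ e d).trans (hN.den_steps h₂ e d).symm

theorem BetaEq.lev_eq {ℓ : ℕ → Prop} {k k' : Bool} {M N : Tm} (h : BetaEq M N) (hM : Lev ℓ k M)
    (hN : Lev ℓ k' N) : k = k' := by
  obtain ⟨V, h₁, h₂⟩ := h.common_reduct
  have h₃ := hM.steps h₁
  have h₄ := hN.steps h₂
  cases k <;> cases k'
  · rfl
  · exact (h₄.not_kind h₃).elim
  · exact (h₃.not_kind h₄).elim
  · rfl

theorem Steps.sort_eq {s : Srt} {M : Tm} (h : Steps (.sort s) M) : M = .sort s := by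
  induction h with
  | refl => rfl
  | tail _ h ih => subst ih; cases h

theorem BetaEq.not_lev_kind {ℓ : ℕ → Prop} {k : Bool} {M : Tm} (h : BetaEq (.sort .kind) M) :
    ¬ Lev ℓ k M := by
  intro hM
  obtain ⟨V, h₁, h₂⟩ := h.common_reduct
  have h₃ := hM.steps h₂
  rw [h₁.sort_eq] at h₃
  cases h₃

/-- The variables of a context that stand for type constructors. -/
def Ctx.lev : Ctx → ℕ → Prop
  | [] => fun _ => False
  | T :: Γ => push (Lev (Ctx.lev Γ) false T) (Ctx.lev Γ)

/-- The possible levels of a judgment `M : T`. -/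
def LevJudgment (ℓ : ℕ → Prop) (M T : Tm) : Prop :=
  (T = .sort .kind ∧ Lev ℓ false M) ∨ (Lev ℓ false T ∧ Lev ℓ true M) ∨ Lev ℓ true T

theorem LevJudgment.of_star {ℓ : ℕ → Prop} {M : Tm} (h : LevJudgment ℓ M (.sort .star)) :
    Lev ℓ true M := by
  obtain ⟨h, _⟩ | ⟨_, h⟩ | h := h
  · cases h
  · exact h
  · cases h

theorem LevJudgment.of_kind {ℓ : ℕ → Prop} {M : Tm} (h : LevJudgment ℓ M (.sort .kind)) :
    Lev ℓ false M := by
  obtain ⟨_, h⟩ | ⟨h, _⟩ | h := h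
  · exact h
  · cases h
  · cases h

theorem LevJudgment.exists_lev {ℓ : ℕ → Prop} {M : Tm} {s : Srt} (h : LevJudgment ℓ M (.sort s)) :
    ∃ k, Lev ℓ k M := by
  cases s
  · exact ⟨_, h.of_star⟩
  · exact ⟨_, h.of_kind⟩

theorem LevJudgment.of_lev {ℓ : ℕ → Prop} {M T : Tm} (h : LevJudgment ℓ M T)
    (hT : Lev ℓ false T) : Lev ℓ true M := by
  obtain ⟨rfl, _⟩ | ⟨_, h⟩ | h := h
  · cases hT
  · exact h
  · exact (h.not_kind hT).elim

theorem Typing.levJudgment {Γ : Ctx} {M T : Tm} (h : Typing Γ M T) :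
    LevJudgment (Ctx.lev Γ) M T := by
  induction h with
  | ax => exact .inl ⟨rfl, .star⟩
  | @var Γ T s _ ih =>
    cases s with
    | star => exact .inr (.inr (ih.of_star.rename fun _ => id))
    | kind => exact .inr (.inl ⟨ih.of_kind.rename fun _ => id, .var ih.of_kind⟩)
  | weak _ _ ih _ =>
    obtain ⟨rfl, h⟩ | ⟨h₁, h₂⟩ | h := ih
    · exact .inl ⟨rfl, h.rename fun _ => id⟩
    · exact .inr (.inl ⟨h₁.rename fun _ => id, h₂.rename fun _ => id⟩)
    · exact .inr (.inr (h.rename fun _ => id))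
  | conv _ _ hβ ih₁ ih₂ =>
    obtain ⟨k, hU⟩ := ih₂.exists_lev
    obtain ⟨rfl, _⟩ | ⟨h₁, h₂⟩ | h := ih₁
    · exact (hβ.not_lev_kind hU).elim
    · obtain rfl := hβ.lev_eq h₁ hU
      exact .inr (.inl ⟨hU, h₂⟩)
    · obtain rfl := hβ.lev_eq h hU
      exact .inr (.inr hU)
  | @pi Γ U T s₁ s₂ hs _ _ ih₁ ih₂ =>
    cases s₁ with
    | star =>
      have hU := ih₁.of_star
      have up : ∀ n, Ctx.lev (U :: Γ) n → push False (Ctx.lev Γ) n := by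
        intro n hn
        cases n with
        | zero => exact hU.not_kind hn
        | succ n => exact hn
      cases s₂ with
      | star => exact .inr (.inl ⟨.star, .piType hU (ih₂.of_star.mono up)⟩)
      | kind => exact .inl ⟨rfl, .piType hU (ih₂.of_kind.mono up)⟩
    | kind =>
      cases s₂ with
      -- The exclusion of (Kind, Kind) enters here.
      | kind => exact (hs ⟨rfl, rfl⟩).elim
      | star =>
        refine .inr (.inl ⟨.star, .piKind ih₁.of_kind (ih₂.of_star.mono fun n hn => ?_)⟩)
        cases n with
        | zero => trivial
        | succ n => exact hn
  | @lam Γ U T b s _ _ ih₁ ih₂ =>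
    -- If the product is a type, the abstraction is an object and nothing is required of it; if it
    -- is a kind, its domain must be a type.
    obtain ⟨k, h⟩ := ih₁.exists_lev
    cases k with
    | true => exact .inr (.inr h)
    | false =>
      cases h with
      | piType hU hT =>
        refine .inr (.inl ⟨.piType hU hT, .lam ((ih₂.of_lev (hT.mono fun n hn => ?_)).mono
          fun n hn => ?_)⟩)
        · cases n with
          | zero => exact hn.elim
          | succ n => exact hn
        · cases n with
          | zero => exact hU.not_kind hn
          | succ n => exact hn
  | app _ _ ih₁ ih₂ =>
    obtain ⟨h, _⟩ | ⟨h, hf⟩ | h := ih₁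
    · cases h
    · cases h with
      | piType _ hT => exact .inr (.inl ⟨hT.inst False.elim, .app hf⟩)
    · cases h with
      | piType _ hT => exact .inr (.inr (hT.inst False.elim))
      | piKind hU hT => exact .inr (.inr (hT.inst fun _ => ih₂.of_lev hU))

theorem Typing.lev_type {Γ : Ctx} {M T : Tm} (h : Typing Γ M T) :
    T = .sort .kind ∨ ∃ k, Lev (Ctx.lev Γ) k T := by
  obtain ⟨h, _⟩ | ⟨h, _⟩ | h := h.levJudgment
  · exact .inl h
  · exact .inr ⟨_, h⟩
  · exact .inr ⟨_, h⟩

/-! ### Soundness -/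

/-- The valuation `e`, `d` satisfies the context. -/
def Sat : Ctx → (ℕ → Set ℕ) → (ℕ → Fam) → Prop
  | [], _, _ => True
  | T :: Γ, e, d => Sat Γ (e ∘ Nat.succ) (d ∘ Nat.succ) ∧
      e 0 ∈ den T (e ∘ Nat.succ) (d ∘ Nat.succ) []

theorem Typing.sound {Γ : Ctx} {M T : Tm} (h : Typing Γ M T) {e : ℕ → Set ℕ} {d : ℕ → Fam}
    (hΓ : Sat Γ e d) : obj M e ∈ den T e d [] := by
  induction h generalizing e d with
  | ax => exact rfl
  | var _ _ =>
    rw [Tm.shift, den_rename]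
    exact hΓ.2
  | weak _ _ ih _ =>
    rw [Tm.shift, Tm.shift, obj_rename, den_rename]
    exact ih hΓ.1
  | conv hM hU hβ ih _ =>
    obtain ⟨k, hU⟩ := hU.levJudgment.exists_lev
    obtain rfl | ⟨k', hT⟩ := hM.lev_type
    · exact (hβ.not_lev_kind hU).elim
    · rw [← hβ.den_eq hT hU]
      exact ih hΓ
  -- A product has object value `∅`, the sole member of the value of a sort.
  | pi _ _ _ _ _ => exact rfl
  | lam _ _ _ ih =>
    intro a ha P
    rw [ap_obj_lam]
    exact ih ⟨hΓ, ha⟩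
  | app _ _ ih₁ ih₂ =>
    rw [den_inst]
    -- The product ranges over all families, so it may be taken at the value of the argument.
    exact ih₁ hΓ _ (ih₂ hΓ) _

/-! ### Derived typing rules -/

theorem Typing.star_kind {Γ : Ctx} {M T : Tm} (h : Typing Γ M T) :
    Typing Γ .star (.sort .kind) := by
  induction h with
  | ax => exact .ax
  | var h ih => exact ih.weak h
  | weak _ h ih _ => exact ih.weak h
  | conv _ _ _ ih _ => exact ih
  | pi _ _ _ ih _ => exact ih
  | lam _ _ ih _ => exact ih
  | app _ _ ih _ => exact ih

theorem Typing.arrow {Γ : Ctx} {A B : Tm} {s : Srt} (hA : Typing Γ A .star)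
    (hB : Typing Γ B (.sort s)) : Typing Γ (arrow A B) (.sort s) :=
  .pi (by simp) hA (hB.weak hA)

theorem Typing.app_arrow {Γ : Ctx} {A B f a : Tm} (hf : Typing Γ f (LambdaP2.arrow A B))
    (ha : Typing Γ a A) : Typing Γ (.app f a) B := by
  have := Typing.app hf ha
  rwa [Tm.inst_shift] at this

theorem shift_arrow (A B : Tm) : (arrow A B).shift = arrow A.shift B.shift := by
  simp only [arrow, Tm.shift, Tm.rename, Tm.rename_rename]
  rfl

theorem Typing.leibnizEq {Γ : Ctx} {σ t q : Tm} (hσ : Typing Γ σ .star) (ht : Typing Γ t σ)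
    (hq : Typing Γ q σ) : Typing Γ (leibnizEq σ t q) .star := by
  have hP : Typing Γ (LambdaP2.arrow σ .star) (.sort .kind) := hσ.arrow hσ.star_kind
  have h₀ : Typing (LambdaP2.arrow σ .star :: Γ) (.var 0) (LambdaP2.arrow σ.shift .star) := by
    have := Typing.var hP
    rwa [shift_arrow] at this
  exact .pi (by simp) hP ((h₀.app_arrow (ht.weak hP)).arrow (h₀.app_arrow (hq.weak hP)))

/-! ### Values of Leibniz equalities and of class maps -/

theorem ap_obj_arrow {A B : Tm} {e : ℕ → Set ℕ} {d : ℕ → Fam} {f a : Set ℕ}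
    (hf : f ∈ den (arrow A B) e d []) (ha : a ∈ den A e d []) : ap f a ∈ den B e d [] := by
  have := hf a ha fun _ => ∅
  rwa [den_shift] at this

theorem obj_eq_of_mem_den_leibnizEq {σ t q : Tm} {e : ℕ → Set ℕ} {d : ℕ → Fam} {m : Set ℕ}
    (h : m ∈ den (leibnizEq σ t q) e d []) : obj t e = obj q e := by
  -- A family that separates `t` from everything else: inhabited (by all sets) exactly at the value
  -- of `t`.
  let P : Fam := fun l => {_x | l = [obj t e]}
  -- The predicate's object part may be `∅`, since applying `∅` always gives `∅`, the element of
  -- `⋆`.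
  have h₁ := h ∅ (fun a _ _ => by rw [ap_empty]; exact rfl) P
  have h₂ := ap_obj_arrow (a := ∅) h₁ (by
    change [obj t.shift _] = [obj t e]
    rw [obj_shift])
  have h₃ : [obj q.shift _] = [obj t e] := h₂
  rw [obj_shift] at h₃
  exact (List.cons.inj h₃).1.symm

theorem obj_eq_of_mem_den_resp {σ τ R f : Tm} {e : ℕ → Set ℕ} {d : ℕ → Fam} {m a b r : Set ℕ}
    (h : m ∈ den (resp σ τ R f) e d []) (ha : a ∈ den σ e d []) (hb : b ∈ den σ e d [])
    (hr : r ∈ den R e d [a, b]) : ap (obj f e) a = ap (obj f e) b := by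
  -- The families for the two points are dummies that weakening discards.
  have h₁ := h a ha (fun _ => ∅) b (by rwa [den_shift]) (fun _ => ∅)
  have h₂ := ap_obj_arrow (a := r) h₁ (by
    change r ∈ den R.shift.shift _ _ [_, _]
    rw [den_shift, den_shift]
    exact hr)
  have h₃ := obj_eq_of_mem_den_leibnizEq h₂
  simp only [obj, obj_shift] at h₃
  exact h₃

/-- The context `α : ⋆, y : α, x : α`. -/
abbrev twoPoints : Ctx := [.var 1, .var 0, .star]

theorem twoPoints_type : Typing twoPoints (.var 2) .star ∧ Typing twoPoints (.var 1) (.var 2) ∧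
    Typing twoPoints (.var 0) (.var 2) := by
  have h₁ : Typing [.star] (.var 0) .star := .var .ax
  have h₂ : Typing [.var 0, .star] (.var 1) .star := h₁.weak h₁
  have h₃ : Typing [.var 0, .star] (.var 0) (.var 1) := .var h₁
  exact ⟨h₂.weak h₂, h₃.weak h₂, .var h₂⟩

/-- The constant relation with value `B` on `σ`, where `B` lives under two additional binders. -/
def constRel (σ B : Tm) : Tm := .lam σ (.lam σ.shift B)

theorem constRel_typed {Γ : Ctx} {σ B : Tm} (hσ : Typing Γ σ .star)
    (hB : Typing (σ.shift :: σ :: Γ) B .star) : Typing Γ (constRel σ B) (relOn σ) := by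
  have h₁ := hσ.arrow hσ.star_kind
  have h₂ := hσ.arrow h₁
  refine .lam h₂ ?_
  rw [shift_arrow]
  exact .lam (by have := h₁.weak hσ; rwa [shift_arrow] at this) hB

/-- Absurdity, `Π α : ⋆. α`. -/
def absurdTy : Tm := .pi .star (.var 0)

theorem absurdTy_typed {Γ : Ctx} {M T : Tm} (h : Typing Γ M T) : Typing Γ absurdTy .star :=
  .pi (by simp) h.star_kind (.var h.star_kind)

theorem exists_resp_absurdTy {Γ : Ctx} {σ τ f : Tm} (hσ : Typing Γ σ .star)
    (hτ : Typing Γ τ .star) (hf : Typing Γ f (arrow σ τ)) :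
    ∃ p, Typing Γ p (resp σ τ (constRel σ absurdTy) f) := by
  have hσ₁ := hσ.weak hσ
  have hx : Typing (σ.shift :: σ :: Γ) (.var 1) σ.shift.shift := (Typing.var hσ).weak hσ₁
  have hy : Typing (σ.shift :: σ :: Γ) (.var 0) σ.shift.shift := .var hσ₁
  have hf₂ := (hf.weak hσ).weak hσ₁
  rw [shift_arrow, shift_arrow] at hf₂
  have hE := ((hτ.weak hσ).weak hσ₁).leibnizEq (hf₂.app_arrow hx) (hf₂.app_arrow hy)
  set E := leibnizEq τ.shift.shift (.app f.shift.shift (.var 1)) (.app f.shift.shift (.var 0))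
  have hR₂ := ((constRel_typed hσ (absurdTy_typed hy)).weak hσ).weak hσ₁
  simp only [relOn, shift_arrow] at hR₂
  have hR := (hR₂.app_arrow hx).app_arrow hy
  have hRE := hR.arrow hE
  have hβ : BetaEq (.app (.app (constRel σ absurdTy).shift.shift (.var 1)) (.var 0)) absurdTy :=
    .trans _ _ _ (.rel _ _ (.appL _ (.beta _ _ _))) (.rel _ _ (.beta _ _ _))
  set R := Tm.app (.app (constRel σ absurdTy).shift.shift (.var 1)) (.var 0)
  have hβ₁ : BetaEq R.shift absurdTy :=
    .trans _ _ _ (.rel _ _ (.appL _ (.beta _ _ _))) (.rel _ _ (.beta _ _ _))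
  have hE₁ := hE.weak hR
  have hh : Typing (R :: σ.shift :: σ :: Γ) (.var 0) absurdTy :=
    (Typing.var hR).conv (absurdTy_typed hE₁) hβ₁
  -- Ex falso: a proof of absurdity is applied to the desired equation itself.
  have h₁ : Typing (σ.shift :: σ :: Γ) (.lam R (.app (.var 0) E.shift)) (arrow R E) :=
    .lam hRE (hh.app hE₁)
  have h₂ := Typing.pi (by simp) hσ₁ hRE
  exact ⟨_, .lam (.pi (by simp) hσ h₂) (.lam h₂ h₁)⟩

theorem obj_clsAt_constRel (c σ B : Tm) (e : ℕ → Set ℕ) (hσ : obj σ e = ∅)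
    (hB : ∀ a b, obj B (push b (push a e)) = ∅) :
    obj (clsAt c σ (constRel σ B)) e = ap (ap (obj c e) ∅) ∅ := by
  simp only [clsAt, constRel, obj, hσ, hB, graph_empty]

/-- No parametric quotient type exists: for the full relation the class map is constant, for the
empty relation it has a left inverse, but its value does not depend on the relation. -/
theorem ParametricQuotient.false (q : ParametricQuotient) : False := by
  obtain ⟨hα, hy, hx⟩ := twoPoints_type
  -- The points are `x ↦ ∅` and `y ↦ Set.univ`; `α` has object value `∅`, as membership in `⋆`
  -- demands.
  let e : ℕ → Set ℕ := push ∅ (push Set.univ fun _ => ∅)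
  let d : ℕ → Fam := fun _ _ => Set.univ
  have hsat : Sat twoPoints e d := ⟨⟨⟨trivial, rfl⟩, trivial⟩, trivial⟩
  -- Under the two binders of the relation, `.var 4` is `α`, whose value is everything, so any two
  -- points are related.
  obtain ⟨M, hM⟩ := q.cls_resp twoPoints (.var 2) (constRel (.var 2) (.var 4)) hα
    (constRel_typed hα ((hα.weak hα).weak (hα.weak hα)))
  have h₁ := obj_eq_of_mem_den_resp (a := ∅) (b := Set.univ) (r := ∅) (hM.sound hsat)
    trivial trivial trivial
  rw [obj_clsAt_constRel q.cls _ _ _ rfl fun _ _ => rfl] at h₁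
  have hid : Typing twoPoints (.lam (.var 2) (.var 0)) (arrow (.var 2) (.var 2)) :=
    .lam (hα.arrow hα) (.var hα)
  obtain ⟨p, hp⟩ := exists_resp_absurdTy hα hα hid
  have hrec := q.recq_cls _ _ _ _ p _ hα
    (constRel_typed hα (absurdTy_typed ((hα.weak hα).weak (hα.weak hα)))) hα hid hp
  have h₂ := (hrec _ hx).obj_eq e
  have h₃ := (hrec _ hy).obj_eq e
  rw [obj, obj, obj_clsAt_constRel q.cls _ _ _ rfl fun _ _ => rfl, obj, obj, ap_obj_lam] at h₂ h₃
  -- Apply the left inverse from the absurd relation to the identification from the full one.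
  have h₄ : (∅ : Set ℕ) = Set.univ := h₂.symm.trans ((congrArg _ h₁).trans h₃)
  exact Set.empty_ne_univ h₄

end LambdaP2

theorem mainTheorem2 : IsEmpty LambdaP2.ParametricQuotient := by
  exact ⟨LambdaP2.ParametricQuotient.false⟩
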